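/- Let $\mathbb T$ be the set of isomorphism classes of (finite, non-empty, non-planar) rooted trees. For $t\in\mathbb T$ let $V(t)$, $E(t)$ be its sets of vertices and edges and $|t|=\#V(t)$. For $s,t\in\mathbb T$ and $v\in V(s)$ let $s\cup_v t$ be the rooted tree obtained by joining the root of $t$ to the vertex $v$ of $s$ by a new edge. For $e\in E(t)$ let $R_e(t)$ be the component containing the root after $e$ is cut, and $P_e(t)$ the other component, rooted at the endpoint of $e$. For $r,p,t\in\mathbb T$ put $$c(r,p;t)=\#\{e\in E(t): R_e(t)= r,\ P_e(t)= p\},\qquad a(r,p;t)=\#\{v\in V(r): r\cup_v p= t\}.$$ Let $\mathfrak g$ (the insertion-elimination Lie algebra on rooted trees) be the complex Lie algebra with generators $D^+_t, D^-_t$ ($t\in\mathbb T$) and $d$, and relations, for all $t,t_1,t_2\in\mathbb T$, $$[D^+_{t_1},D^+_{t_2}]=\sum_{v\in V(t_2)}D^+_{t_2\cup_v t_1}-\sum_{v\in V(t_1)}D^+_{t_1\cup_v t_2},$$ $$[D^-_{t_1},D^-_{t_2}]=\sum_{t\in\mathbb T}c(t_1,t_2;t)\,D^-_t-\sum_{t\in\mathbb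 T}c(t_2,t_1;t)\,D^-_t,$$ $$[D^-_{t_1},D^+_{t_2}]=\sum_{t\in\mathbb T}c(t,t_1;t_2)\,D^+_t+\sum_{t\in\mathbb T}a(t,t_2;t_1)\,D^-_t\qquad(t_1\ne t_2),$$ $$[D^-_t,D^+_t]=d,\qquad [d,D^-_t]=-|t|D^-_t,\qquad [d,D^+_t]=|t|D^+_t$$ (all sums are finite). These are the commutation relations of the operators $D^+_t(s)=\sum_{v\in V(s)}s\cup_v t$, $D^-_t(s)=\sum_{e\in E(s),\,P_e(s)=t}R_e(s)$, $d(s)=|s|\,s$ on the complex vector space spanned by rooted trees. Let $V$ be a representation of $\mathfrak g$ on a complex vector space (of any dimension) which is non-trivial, i.e. some element of $\mathfrak g$ acts on $V$ by a non-zero operator. Then $V$ is faithful: the homomorphism $\mathfrak g\to\mathfrak{gl}(V)$ is injective. -/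

import Mathlib

/-- Planar (ordered) rooted trees, generated by the one-vertex tree `dot` and the operation
`join s t`, which joins the root of `t` to the root of `s` by a new edge (as a new first branch).
The root of `join s t` is the root of `s`. -/
inductive PlanarTree : Type
  | dot : PlanarTree
  | join (s t : PlanarTree) : PlanarTree

namespace PlanarTree

/-- The vertices of a tree. -/
def Vertex : PlanarTree → Type
  | dot => Unit
  | join s t => Vertex s ⊕ Vertex t

/-- The edges of a tree; the `Unit` summand is the edge joining the two roots. -/
def Edge : PlanarTree → Type
  | dot => Empty
  | join s t => Unit ⊕ (Edge s ⊕ Edge t)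

instance instFintypeVertex : (t : PlanarTree) → Fintype (Vertex t)
  | dot => inferInstanceAs (Fintype Unit)
  | join s t =>
    letI := instFintypeVertex s
    letI := instFintypeVertex t
    inferInstanceAs (Fintype (Vertex s ⊕ Vertex t))

instance instFintypeEdge : (t : PlanarTree) → Fintype (Edge t)
  | dot => inferInstanceAs (Fintype Empty)
  | join s t =>
    letI := instFintypeEdge s
    letI := instFintypeEdge t
    inferInstanceAs (Fintype (Unit ⊕ (Edge s ⊕ Edge t)))

/-- `attach s v t` is `s ∪_v t`: the root of `t` is joined to the vertex `v` of `s` by an edge. -/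
def attach : (s : PlanarTree) → Vertex s → PlanarTree → PlanarTree
  | dot, _, t => join dot t
  | join s u, Sum.inl v, t => join (attach s v t) u
  | join s u, Sum.inr v, t => join s (attach u v t)

/-- The component containing the root after the edge `e` is cut. -/
def rootPart : (t : PlanarTree) → Edge t → PlanarTree
  | dot, e => Empty.elim e
  | join s _, Sum.inl _ => s
  | join s t, Sum.inr (Sum.inl e) => join (rootPart s e) t
  | join s t, Sum.inr (Sum.inr e) => join s (rootPart t e)

/-- The component not containing the root after the edge `e` is cut, rooted at the endpoint
of `e`. -/
def prunedPart : (t : PlanarTree) → Edge t → PlanarTree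
  | dot, e => Empty.elim e
  | join _ t, Sum.inl _ => t
  | join s _, Sum.inr (Sum.inl e) => prunedPart s e
  | join _ t, Sum.inr (Sum.inr e) => prunedPart t e

/-- Isomorphism of the underlying rooted trees: two planar rooted trees are isomorphic as rooted
trees iff one is obtained from the other by repeatedly exchanging neighbouring branches at
vertices. -/
inductive Iso : PlanarTree → PlanarTree → Prop
  | refl (t : PlanarTree) : Iso t t
  | symm {s t : PlanarTree} : Iso s t → Iso t s
  | trans {s t u : PlanarTree} : Iso s t → Iso t u → Iso s u
  | join {s s' t t' : PlanarTree} : Iso s s' → Iso t t' → Iso (join s t) (join s' t')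
  | swap (s t u : PlanarTree) :
      Iso (PlanarTree.join (PlanarTree.join s t) u) (PlanarTree.join (PlanarTree.join s u) t)

instance setoid : Setoid PlanarTree where
  r := Iso
  iseqv := ⟨Iso.refl, Iso.symm, Iso.trans⟩

theorem Iso.attach_right (s : PlanarTree) (v : Vertex s) {t t' : PlanarTree} (h : Iso t t') :
    Iso (attach s v t) (attach s v t') := by
  induction s with
  | dot => exact Iso.join (Iso.refl _) h
  | join s u ihs ihu =>
    rcases v with v | v
    · exact Iso.join (ihs v) (Iso.refl _)
    · exact Iso.join (Iso.refl _) (ihu v)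

theorem Iso.exists_vertexEquiv {s s' : PlanarTree} (h : Iso s s') :
    ∃ φ : Vertex s ≃ Vertex s', ∀ v t, Iso (attach s v t) (attach s' (φ v) t) := by
  induction h with
  | refl t => exact ⟨Equiv.refl _, fun _ _ => Iso.refl _⟩
  | symm _ ih =>
    obtain ⟨φ, hφ⟩ := ih
    exact ⟨φ.symm, fun v t => by simpa using (hφ (φ.symm v) t).symm⟩
  | trans _ _ ih₁ ih₂ =>
    obtain ⟨φ, hφ⟩ := ih₁
    obtain ⟨ψ, hψ⟩ := ih₂
    exact ⟨φ.trans ψ, fun v t => (hφ v t).trans (hψ (φ v) t)⟩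
  | join h₁ h₂ ih₁ ih₂ =>
    obtain ⟨φ, hφ⟩ := ih₁
    obtain ⟨ψ, hψ⟩ := ih₂
    refine ⟨Equiv.sumCongr φ ψ, ?_⟩
    rintro (v | v) t
    · exact Iso.join (hφ v t) h₂
    · exact Iso.join h₁ (hψ v t)
  | swap s t u =>
    refine ⟨⟨fun | .inl (.inl v) => .inl (.inl v) | .inl (.inr v) => .inr v
                 | .inr v => .inl (.inr v),
             fun | .inl (.inl v) => .inl (.inl v) | .inl (.inr v) => .inr v
                 | .inr v => .inl (.inr v), ?_, ?_⟩, ?_⟩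
    · rintro ((v | v) | v) <;> rfl
    · rintro ((v | v) | v) <;> rfl
    · rintro ((v | v) | v) w <;> exact Iso.swap _ _ _

theorem Iso.exists_edgeEquiv {s s' : PlanarTree} (h : Iso s s') :
    ∃ φ : Edge s ≃ Edge s', ∀ e, Iso (rootPart s e) (rootPart s' (φ e)) ∧
      Iso (prunedPart s e) (prunedPart s' (φ e)) := by
  induction h with
  | refl t => exact ⟨Equiv.refl _, fun _ => ⟨Iso.refl _, Iso.refl _⟩⟩
  | symm _ ih =>
    obtain ⟨φ, hφ⟩ := ih
    refine ⟨φ.symm, fun e => ?_⟩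
    have := hφ (φ.symm e)
    rw [Equiv.apply_symm_apply] at this
    exact ⟨this.1.symm, this.2.symm⟩
  | trans _ _ ih₁ ih₂ =>
    obtain ⟨φ, hφ⟩ := ih₁
    obtain ⟨ψ, hψ⟩ := ih₂
    exact ⟨φ.trans ψ, fun e =>
      ⟨(hφ e).1.trans (hψ (φ e)).1, (hφ e).2.trans (hψ (φ e)).2⟩⟩
  | join h₁ h₂ ih₁ ih₂ =>
    obtain ⟨φ, hφ⟩ := ih₁
    obtain ⟨ψ, hψ⟩ := ih₂
    refine ⟨Equiv.sumCongr (Equiv.refl _) (Equiv.sumCongr φ ψ), ?_⟩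
    rintro (e | e | e)
    · exact ⟨h₁, h₂⟩
    · exact ⟨Iso.join (hφ e).1 h₂, (hφ e).2⟩
    · exact ⟨Iso.join h₁ (hψ e).1, (hψ e).2⟩
  | swap s t u =>
    refine ⟨⟨fun | .inl a => .inr (.inl (.inl a)) | .inr (.inl (.inl a)) => .inl a
                 | .inr (.inl (.inr (.inl e))) => .inr (.inl (.inr (.inl e)))
                 | .inr (.inl (.inr (.inr e))) => .inr (.inr e)
                 | .inr (.inr e) => .inr (.inl (.inr (.inr e))),
             fun | .inl a => .inr (.inl (.inl a)) | .inr (.inl (.inl a)) => .inl a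
                 | .inr (.inl (.inr (.inl e))) => .inr (.inl (.inr (.inl e)))
                 | .inr (.inl (.inr (.inr e))) => .inr (.inr e)
                 | .inr (.inr e) => .inr (.inl (.inr (.inr e))), ?_, ?_⟩, ?_⟩
    · rintro (e | ((e | e | e) | e)) <;> rfl
    · rintro (e | ((e | e | e) | e)) <;> rfl
    · rintro (e | ((e | e | e) | e)) <;>
        first
          | exact ⟨Iso.refl _, Iso.refl _⟩
          | exact ⟨Iso.swap _ _ _, Iso.refl _⟩

theorem card_vertex_join (s t : PlanarTree) :
    Fintype.card (Vertex (join s t)) = Fintype.card (Vertex s) + Fintype.card (Vertex t) :=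
  Fintype.card_sum

theorem card_vertex_pos (t : PlanarTree) : 0 < Fintype.card (Vertex t) := by
  induction t with
  | dot => exact Nat.one_pos
  | join s t ihs iht => rw [card_vertex_join]; omega

theorem card_vertex_attach (s : PlanarTree) (v : Vertex s) (t : PlanarTree) :
    Fintype.card (Vertex (attach s v t)) =
      Fintype.card (Vertex s) + Fintype.card (Vertex t) := by
  induction s with
  | dot => exact card_vertex_join _ _
  | join s u ihs ihu =>
    have h := card_vertex_join s u
    rcases v with v | v
    · have := ihs v
      have h' := card_vertex_join (attach s v t) u
      change Fintype.card (Vertex (join (attach s v t) u)) = _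
      omega
    · have := ihu v
      have h' := card_vertex_join s (attach u v t)
      change Fintype.card (Vertex (join s (attach u v t))) = _
      omega

theorem card_vertex_cut (t : PlanarTree) (e : Edge t) :
    Fintype.card (Vertex (rootPart t e)) + Fintype.card (Vertex (prunedPart t e)) =
      Fintype.card (Vertex t) := by
  induction t with
  | dot => exact Empty.elim e
  | join s u ihs ihu =>
    have h := card_vertex_join s u
    rcases e with e | e | e
    · exact h.symm
    · have := ihs e
      have h' := card_vertex_join (rootPart s e) u
      change Fintype.card (Vertex (join (rootPart s e) u)) +
        Fintype.card (Vertex (prunedPart s e)) = _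
      omega
    · have := ihu e
      have h' := card_vertex_join s (rootPart u e)
      change Fintype.card (Vertex (join s (rootPart u e))) +
        Fintype.card (Vertex (prunedPart u e)) = _
      omega

theorem finite_card_le (n : ℕ) : {t : PlanarTree | Fintype.card (Vertex t) ≤ n}.Finite := by
  induction n with
  | zero =>
    refine Set.finite_empty.subset fun t ht => ?_
    have := card_vertex_pos t
    simp only [Set.mem_ofPred_eq] at ht
    omega
  | succ n ih =>
    refine ((Set.finite_singleton dot).union (Set.Finite.image2 join ih ih)).subset ?_
    rintro (_ | ⟨s, t⟩) ht
    · exact Or.inl rfl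
    · simp only [Set.mem_ofPred_eq, card_vertex_join] at ht
      have hs := card_vertex_pos s
      have ht' := card_vertex_pos t
      exact Or.inr ⟨s, by simp only [Set.mem_ofPred_eq]; omega, t,
        by simp only [Set.mem_ofPred_eq]; omega, rfl⟩

end PlanarTree

/-- (Non-empty, finite, non-planar) rooted trees up to isomorphism. -/
def RTree : Type := Quotient PlanarTree.setoid

namespace RTree

/-- The rooted tree underlying a planar rooted tree. -/
def mk (p : PlanarTree) : RTree := Quotient.mk PlanarTree.setoid p

/-- A chosen representative. Nothing below depends on the choice, see `exists_vertexEquiv` and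
`exists_edgeEquiv`. -/
noncomputable def rep (t : RTree) : PlanarTree := Quotient.out t

theorem mk_rep (t : RTree) : mk t.rep = t := Quotient.out_eq t

theorem mk_eq_mk {p q : PlanarTree} : mk p = mk q ↔ PlanarTree.Iso p q := Quotient.eq

/-- `V(t)` -/
abbrev Vertex (t : RTree) : Type := t.rep.Vertex

/-- `E(t)` -/
abbrev Edge (t : RTree) : Type := t.rep.Edge

/-- `|t|`, the number of vertices. -/
noncomputable def size (t : RTree) : ℕ := Fintype.card t.Vertex

/-- `s ∪_v t` -/
noncomputable def attach (s : RTree) (v : s.Vertex) (t : RTree) : RTree :=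
  mk (s.rep.attach v t.rep)

/-- `R_e(t)`, the component containing the root after cutting `e`. -/
noncomputable def rootPart (t : RTree) (e : t.Edge) : RTree := mk (t.rep.rootPart e)

/-- `P_e(t)`, the other component after cutting `e`. -/
noncomputable def prunedPart (t : RTree) (e : t.Edge) : RTree := mk (t.rep.prunedPart e)

theorem exists_vertexEquiv (p : PlanarTree) :
    ∃ φ : (mk p).Vertex ≃ p.Vertex,
      ∀ v (q : PlanarTree), (mk p).attach v (mk q) = mk (p.attach (φ v) q) := by
  obtain ⟨φ, hφ⟩ := PlanarTree.Iso.exists_vertexEquiv (mk_eq_mk.1 (mk_rep (mk p)))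
  refine ⟨φ, fun v q => mk_eq_mk.2 ?_⟩
  exact (hφ v _).trans (PlanarTree.Iso.attach_right _ _ (mk_eq_mk.1 (mk_rep (mk q))))

theorem exists_edgeEquiv (p : PlanarTree) :
    ∃ φ : (mk p).Edge ≃ p.Edge, ∀ e, (mk p).rootPart e = mk (p.rootPart (φ e)) ∧
      (mk p).prunedPart e = mk (p.prunedPart (φ e)) := by
  obtain ⟨φ, hφ⟩ := PlanarTree.Iso.exists_edgeEquiv (mk_eq_mk.1 (mk_rep (mk p)))
  exact ⟨φ, fun e => ⟨mk_eq_mk.2 (hφ e).1, mk_eq_mk.2 (hφ e).2⟩⟩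

theorem size_mk (p : PlanarTree) : (mk p).size = Fintype.card p.Vertex :=
  Fintype.card_congr (exists_vertexEquiv p).choose

/-- The number of edges `e` of `t` with `R_e(t) = r` and `P_e(t) = p`. -/
noncomputable def cutCount (r p t : RTree) : ℕ :=
  Nat.card {e : t.Edge // t.rootPart e = r ∧ t.prunedPart e = p}

/-- The number of vertices `v` of `s` with `s ∪_v u = t`. -/
noncomputable def attachCount (s u t : RTree) : ℕ :=
  Nat.card {v : s.Vertex // s.attach v u = t}

theorem size_of_cutCount_ne_zero {r p t : RTree} (h : cutCount r p t ≠ 0) :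
    r.size + p.size = t.size := by
  have : Nonempty {e : t.Edge // t.rootPart e = r ∧ t.prunedPart e = p} := by
    by_contra hn
    rw [not_nonempty_iff] at hn
    exact h Nat.card_of_isEmpty
  obtain ⟨e, rfl, rfl⟩ := this
  unfold rootPart prunedPart
  rw [size_mk, size_mk]
  exact PlanarTree.card_vertex_cut _ e

theorem size_of_attachCount_ne_zero {s u t : RTree} (h : attachCount s u t ≠ 0) :
    s.size + u.size = t.size := by
  have : Nonempty {v : s.Vertex // s.attach v u = t} := by
    by_contra hn
    rw [not_nonempty_iff] at hn
    exact h Nat.card_of_isEmpty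
  obtain ⟨v, rfl⟩ := this
  unfold attach
  rw [size_mk]
  exact (PlanarTree.card_vertex_attach _ v _).symm

theorem finite_size_le (n : ℕ) : {t : RTree | t.size ≤ n}.Finite := by
  refine ((PlanarTree.finite_card_le n).image mk).subset fun t ht => ?_
  exact ⟨t.rep, ht, mk_rep t⟩

/- The sums over all rooted trees in the relations below are finite. -/

theorem finite_support_cutCount (r p : RTree) :
    (Function.support fun t => cutCount r p t).Finite :=
  (finite_size_le (r.size + p.size)).subset fun _ ht => (size_of_cutCount_ne_zero ht).ge

theorem finite_support_cutCount' (p t : RTree) :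
    (Function.support fun r => cutCount r p t).Finite :=
  (finite_size_le t.size).subset fun _ hr =>
    (Nat.le_add_right _ _).trans (size_of_cutCount_ne_zero hr).le

theorem finite_support_attachCount (u t : RTree) :
    (Function.support fun s => attachCount s u t).Finite :=
  (finite_size_le t.size).subset fun _ hs =>
    (Nat.le_add_right _ _).trans (size_of_attachCount_ne_zero hs).le

end RTree

namespace InsertionElimination

open RTree

/-- The generators `D⁺_t`, `D⁻_t` (for `t` a rooted tree) and `d`. -/
inductive Generator : Type
  | plus (t : RTree) : Generator
  | minus (t : RTree) : Generator
  | deg : Generator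

/-- The free complex Lie algebra on the generators. -/
abbrev Free : Type := FreeLieAlgebra ℂ Generator

noncomputable def Dp (t : RTree) : Free := FreeLieAlgebra.of ℂ (Generator.plus t)

noncomputable def Dm (t : RTree) : Free := FreeLieAlgebra.of ℂ (Generator.minus t)

noncomputable def dd : Free := FreeLieAlgebra.of ℂ Generator.deg

/-- The defining relations: `Relation x y` means that `x = y` is imposed. -/
inductive Relation : Free → Free → Prop
  | plus_plus (t₁ t₂ : RTree) :
      Relation ⁅Dp t₁, Dp t₂⁆
        ((∑ v : t₂.Vertex, Dp (t₂.attach v t₁)) - ∑ v : t₁.Vertex, Dp (t₁.attach v t₂))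
  | minus_minus (t₁ t₂ : RTree) :
      Relation ⁅Dm t₁, Dm t₂⁆
        ((∑ᶠ t : RTree, (cutCount t₁ t₂ t : ℂ) • Dm t) -
          ∑ᶠ t : RTree, (cutCount t₂ t₁ t : ℂ) • Dm t)
  | minus_plus (t₁ t₂ : RTree) (h : t₁ ≠ t₂) :
      Relation ⁅Dm t₁, Dp t₂⁆
        ((∑ᶠ t : RTree, (cutCount t t₁ t₂ : ℂ) • Dp t) +
          ∑ᶠ t : RTree, (attachCount t t₂ t₁ : ℂ) • Dm t)
  | minus_plus_self (t : RTree) : Relation ⁅Dm t, Dp t⁆ dd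
  | deg_minus (t : RTree) : Relation ⁅dd, Dm t⁆ (-((t.size : ℂ) • Dm t))
  | deg_plus (t : RTree) : Relation ⁅dd, Dp t⁆ ((t.size : ℂ) • Dp t)

/-- The ideal generated by the relations. -/
noncomputable def relationIdeal : LieIdeal ℂ Free :=
  LieSubmodule.lieSpan ℂ Free {z | ∃ x y, Relation x y ∧ z = x - y}

end InsertionElimination

/-- The insertion-elimination Lie algebra on rooted trees. -/
abbrev InsertionEliminationAlgebra : Type :=
  InsertionElimination.Free ⧸ InsertionElimination.relationIdeal

/-!
Every non-zero ideal of the insertion-elimination Lie algebra is the whole algebra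
(`eq_top_of_ne_bot`). The kernel of a representation is an ideal, so it is zero unless the
representation is trivial.

The relations show that the algebra is spanned, as a vector space, by the generators
(`span_gen`), and each generator is an eigenvector of `ad d`, the eigenvalue being its weight:
`|t|` for `D⁺_t`, `-|t|` for `D⁻_t` and `0` for `d`. Given a non-zero element `∑ c_g g` of an
ideal with `c_{g₀} ≠ 0`, a Lagrange polynomial in `ad d` extracts the part of the weight of `g₀`,
which therefore also lies in the ideal (`sum_filter_mem_of_eigenvectors`). If `g₀` is `D⁺_t`, that
part is a combination of generators `D⁺_s` with `|s| = |t|`. Its bracket with `D⁻_t` is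
`c_{g₀} d`, because `[D⁻_t, D⁺_s]` vanishes for trees `s ≠ t` of equal size: cutting an edge
strictly decreases the size and grafting a tree strictly increases it (`minus_lie_plus_of_size_eq`).
The case of `D⁻_t` is symmetric, and for `d` there is nothing to do. Hence the ideal contains `d`,
and by bracketing with `d` every `D⁺_t` and `D⁻_t` (`eq_top_of_deg_mem`), as `|t| ≠ 0`.

No linear independence of the generators in the quotient is needed.
-/

/-! ### Invariant subspaces and eigenvectors -/

theorem Submodule.aeval_apply_mem {K M : Type*} [CommRing K] [AddCommGroup M] [Module K M]
    {f : Module.End K M} {N : Submodule K M} (hN : ∀ x ∈ N, f x ∈ N) (p : Polynomial K)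
    {x : M} (hx : x ∈ N) : Polynomial.aeval f p x ∈ N := by
  have hpow : ∀ n : ℕ, (f ^ n) x ∈ N := by
    intro n
    induction n with
    | zero => simpa using hx
    | succ n ih =>
      rw [pow_succ', Module.End.mul_apply]
      exact hN _ ih
  induction p using Polynomial.induction_on' with
  | add p q hp hq =>
    rw [map_add, LinearMap.add_apply]
    exact N.add_mem hp hq
  | monomial n a =>
    rw [Polynomial.aeval_monomial, Module.End.mul_apply, Module.algebraMap_end_apply]
    exact N.smul_mem _ (hpow n)

/-- An invariant subspace that contains a sum of eigenvectors contains the partial sum of those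
with any given eigenvalue. -/
theorem Submodule.sum_filter_mem_of_eigenvectors {ι K M : Type*} [Field K] [DecidableEq K]
    [AddCommGroup M] [Module K M] {f : Module.End K M} {N : Submodule K M}
    (hN : ∀ x ∈ N, f x ∈ N) {s : Finset ι} {v : ι → M} {μ : ι → K}
    (hv : ∀ i, f (v i) = μ i • v i) (hs : ∑ i ∈ s, v i ∈ N) (c : K) :
    ∑ i ∈ s with μ i = c, v i ∈ N := by
  -- A polynomial with value `1` at `c` and `0` at the other eigenvalues.
  let p := Lagrange.basis (insert c (s.image μ)) id c
  have key : Polynomial.aeval f p (∑ i ∈ s, v i) = ∑ i ∈ s with μ i = c, v i := by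
    rw [map_sum, Finset.sum_filter]
    refine Finset.sum_congr rfl fun i hi => ?_
    rw [Module.End.aeval_apply_of_mem_apply_eq_smul (hv i)]
    split_ifs with h
    · have : p.eval (μ i) = 1 := by
        rw [h]
        exact Lagrange.eval_basis_self (v := id) Function.injective_id.injOn
          (Finset.mem_insert_self _ _)
      rw [this, one_smul]
    · have : p.eval (μ i) = 0 :=
        Lagrange.eval_basis_of_ne (v := id) (Ne.symm h)
          (Finset.mem_insert_of_mem (Finset.mem_image_of_mem μ hi))
      rw [this, zero_smul]
  rw [← key]
  exact aeval_apply_mem hN p hs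

theorem RTree.size_pos (t : RTree) : 0 < t.size := PlanarTree.card_vertex_pos _

namespace InsertionElimination

open RTree

/-! ### The images of the generators -/

/-- The projection from the free Lie algebra onto its quotient by the relations. -/
noncomputable def proj : Free →ₗ⁅ℂ⁆ InsertionEliminationAlgebra :=
  { relationIdeal.toSubmodule.mkQ with map_lie' := rfl }

theorem proj_surjective : Function.Surjective proj := Quot.mk_surjective

theorem proj_eq_of_relation {x y : Free} (h : Relation x y) : proj x = proj y :=
  (Submodule.Quotient.eq relationIdeal.toSubmodule).2
    (LieSubmodule.subset_lieSpan ⟨x, y, h, rfl⟩)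

/-- The image of a generator in the insertion-elimination Lie algebra. -/
noncomputable def gen (g : Generator) : InsertionEliminationAlgebra :=
  proj (FreeLieAlgebra.of ℂ g)

/-- The eigenvalue of `ad d` on a generator. -/
noncomputable def weight : Generator → ℤ
  | .plus t => t.size
  | .minus t => -t.size
  | .deg => 0

theorem deg_lie_gen (g : Generator) : ⁅gen .deg, gen g⁆ = (weight g : ℂ) • gen g := by
  cases g with
  | plus t => simpa [gen, weight, Dp, dd] using proj_eq_of_relation (.deg_plus t)
  | minus t => simpa [gen, weight, Dm, dd] using proj_eq_of_relation (.deg_minus t)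
  | deg => simp [weight]

theorem minus_lie_plus_self (t : RTree) : ⁅gen (.minus t), gen (.plus t)⁆ = gen .deg := by
  simpa [gen, Dp, Dm, dd] using proj_eq_of_relation (.minus_plus_self t)

theorem minus_lie_plus_of_size_eq {s t : RTree} (h : s ≠ t) (hsize : s.size = t.size) :
    ⁅gen (.minus s), gen (.plus t)⁆ = 0 := by
  have hc (r : RTree) : cutCount r s t = 0 := by
    by_contra hr
    have := size_of_cutCount_ne_zero hr
    have := r.size_pos
    omega
  have ha (r : RTree) : attachCount r t s = 0 := by
    by_contra hr
    have := size_of_attachCount_ne_zero hr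
    have := r.size_pos
    omega
  simpa [gen, Dp, Dm, hc, ha] using proj_eq_of_relation (.minus_plus s t h)

/-! ### The generators span -/

theorem proj_finsum_smul_mem_span (c : RTree → ℂ) (g : RTree → Generator) :
    proj (∑ᶠ t, c t • FreeLieAlgebra.of ℂ (g t)) ∈ Submodule.span ℂ (Set.range gen) := by
  refine finsum_induction (fun x => proj x ∈ Submodule.span ℂ (Set.range gen)) ?_ ?_ ?_
  · rw [map_zero]
    exact Submodule.zero_mem _
  · intro x y hx hy
    rw [map_add]
    exact Submodule.add_mem _ hx hy
  · intro t
    rw [map_smul]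
    exact Submodule.smul_mem _ _ (Submodule.subset_span ⟨g t, rfl⟩)

theorem proj_sum_mem_span {ι : Type*} (s : Finset ι) (g : ι → Generator) :
    proj (∑ i ∈ s, FreeLieAlgebra.of ℂ (g i)) ∈ Submodule.span ℂ (Set.range gen) := by
  rw [map_sum]
  exact Submodule.sum_mem _ fun i _ => Submodule.subset_span ⟨g i, rfl⟩

theorem lie_gen_gen_mem_span (g h : Generator) :
    ⁅gen g, gen h⁆ ∈ Submodule.span ℂ (Set.range gen) := by
  have hgen (k : Generator) : gen k ∈ Submodule.span ℂ (Set.range gen) :=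
    Submodule.subset_span ⟨k, rfl⟩
  have hmp (s t : RTree) :
      ⁅gen (.minus s), gen (.plus t)⁆ ∈ Submodule.span ℂ (Set.range gen) := by
    by_cases hst : s = t
    · rw [hst, minus_lie_plus_self]
      exact hgen _
    · rw [gen, gen, ← LieHom.map_lie]
      refine (proj_eq_of_relation (.minus_plus s t hst)).symm ▸ ?_
      rw [map_add]
      exact Submodule.add_mem _ (proj_finsum_smul_mem_span _ Generator.plus)
        (proj_finsum_smul_mem_span _ Generator.minus)
  have hdeg (k : Generator) : ⁅gen .deg, gen k⁆ ∈ Submodule.span ℂ (Set.range gen) := by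
    rw [deg_lie_gen]
    exact Submodule.smul_mem _ _ (hgen k)
  have hdeg' (k : Generator) : ⁅gen k, gen .deg⁆ ∈ Submodule.span ℂ (Set.range gen) := by
    rw [← lie_skew]
    exact Submodule.neg_mem _ (hdeg k)
  cases g with
  | deg => exact hdeg h
  | plus s =>
    cases h with
    | deg => exact hdeg' _
    | minus t =>
      rw [← lie_skew]
      exact Submodule.neg_mem _ (hmp t s)
    | plus t =>
      rw [gen, gen, ← LieHom.map_lie]
      refine (proj_eq_of_relation (.plus_plus s t)).symm ▸ ?_
      rw [map_sub]
      exact Submodule.sub_mem _ (proj_sum_mem_span _ fun v => .plus (t.attach v s))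
        (proj_sum_mem_span _ fun v => .plus (s.attach v t))
  | minus s =>
    cases h with
    | deg => exact hdeg' _
    | plus t => exact hmp s t
    | minus t =>
      rw [gen, gen, ← LieHom.map_lie]
      refine (proj_eq_of_relation (.minus_minus s t)).symm ▸ ?_
      rw [map_sub]
      exact Submodule.sub_mem _ (proj_finsum_smul_mem_span _ Generator.minus)
        (proj_finsum_smul_mem_span _ Generator.minus)

/-- The linear span of the generators is closed under the bracket, hence is everything. -/
theorem span_gen : Submodule.span ℂ (Set.range gen) = ⊤ := by
  let S : LieSubalgebra ℂ InsertionEliminationAlgebra :=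
    { Submodule.span ℂ (Set.range gen) with
      lie_mem' := by
        intro x y hx hy
        change x ∈ Submodule.span ℂ (Set.range gen) at hx
        change y ∈ Submodule.span ℂ (Set.range gen) at hy
        change ⁅x, y⁆ ∈ Submodule.span ℂ (Set.range gen)
        induction hx, hy using Submodule.span_induction₂ with
        | mem_mem x y hx hy =>
          obtain ⟨g, rfl⟩ := hx
          obtain ⟨h, rfl⟩ := hy
          exact lie_gen_gen_mem_span g h
        | zero_left y hy => simp
        | zero_right x hx => simp
        | add_left x y z hx hy hz h₁ h₂ => rw [add_lie]; exact Submodule.add_mem _ h₁ h₂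
        | add_right x y z hx hy hz h₁ h₂ => rw [lie_add]; exact Submodule.add_mem _ h₁ h₂
        | smul_left r x y hx hy h => rw [smul_lie]; exact Submodule.smul_mem _ _ h
        | smul_right r x y hx hy h => rw [lie_smul]; exact Submodule.smul_mem _ _ h }
  let f : Free →ₗ⁅ℂ⁆ S :=
    FreeLieAlgebra.lift ℂ fun g => ⟨gen g, Submodule.subset_span ⟨g, rfl⟩⟩
  have hf : S.incl.comp f = proj := by
    refine FreeLieAlgebra.hom_ext fun g => ?_
    rw [LieHom.comp_apply, FreeLieAlgebra.lift_of_apply]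
    rfl
  refine eq_top_iff.2 fun x _ => ?_
  obtain ⟨y, rfl⟩ := proj_surjective x
  rw [← hf]
  exact (f y).2

/-! ### Ideals -/

theorem eq_top_of_deg_mem {I : LieIdeal ℂ InsertionEliminationAlgebra} (h : gen .deg ∈ I) :
    I = ⊤ := by
  rw [← LieSubmodule.toSubmodule_eq_top, eq_top_iff, ← span_gen, Submodule.span_le]
  have of_weight_ne (g : Generator) (hg : weight g ≠ 0) : gen g ∈ I := by
    have := lie_mem_left ℂ _ I (gen .deg) (gen g) h
    rw [deg_lie_gen] at this
    exact (Submodule.smul_mem_iff I.toSubmodule (Int.cast_ne_zero.2 hg)).1 this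
  rintro _ ⟨g, rfl⟩
  cases g with
  | deg => exact h
  | plus t => exact of_weight_ne _ (by have := t.size_pos; simp only [weight]; omega)
  | minus t => exact of_weight_ne _ (by have := t.size_pos; simp only [weight]; omega)

open Classical in
/-- For `D⁺_t` or `D⁻_t`, bracketing with the opposite generator reads off, in multiples of `d`,
its coefficient among the generators of the same weight. -/
theorem exists_lie_gen_eq_ite {g₀ : Generator} (h₀ : g₀ ≠ .deg) :
    ∃ y : InsertionEliminationAlgebra, ∀ g, weight g = weight g₀ →
      ⁅y, gen g⁆ = if g = g₀ then gen .deg else 0 := by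
  cases g₀ with
  | deg => exact absurd rfl h₀
  | plus t =>
    refine ⟨gen (.minus t), fun g hg => ?_⟩
    have ht := t.size_pos
    cases g with
    | deg => simp only [weight] at hg; omega
    | minus s => simp only [weight] at hg; omega
    | plus s =>
      simp only [weight, Nat.cast_inj] at hg
      by_cases hst : s = t
      · rw [hst, if_pos rfl, minus_lie_plus_self]
      · rw [if_neg (by simpa using hst), minus_lie_plus_of_size_eq (Ne.symm hst) hg.symm]
  | minus t =>
    refine ⟨-gen (.plus t), fun g hg => ?_⟩
    have ht := t.size_pos
    cases g with
    | deg => simp only [weight] at hg; omega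
    | plus s => simp only [weight] at hg; omega
    | minus s =>
      simp only [weight, neg_inj, Nat.cast_inj] at hg
      rw [neg_lie, lie_skew]
      by_cases hst : s = t
      · rw [hst, if_pos rfl, minus_lie_plus_self]
      · rw [if_neg (by simpa using hst), minus_lie_plus_of_size_eq hst hg]

open Classical in
theorem eq_top_of_ne_bot {I : LieIdeal ℂ InsertionEliminationAlgebra} (hI : I ≠ ⊥) : I = ⊤ := by
  obtain ⟨z, hzI, hz⟩ :=
    I.toSubmodule.exists_mem_ne_zero_of_ne_bot (by simpa using hI)
  have hspan : z ∈ Submodule.span ℂ (Set.range gen) := span_gen ▸ Submodule.mem_top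
  obtain ⟨c, rfl⟩ := Finsupp.mem_span_range_iff_exists_finsupp.1 hspan
  obtain ⟨g₀, hg₀⟩ : ∃ g₀, c g₀ ≠ 0 := by
    by_contra! h
    obtain rfl : c = 0 := Finsupp.ext h
    exact hz Finsupp.sum_zero_index
  have hhom : ∑ g ∈ c.support with (weight g : ℂ) = (weight g₀ : ℂ), c g • gen g ∈ I := by
    refine Submodule.sum_filter_mem_of_eigenvectors (N := I.toSubmodule)
      (f := LieAlgebra.ad ℂ _ (gen .deg)) (fun x hx => I.lie_mem (x := gen .deg) hx)
      (fun g => ?_) hzI _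
    rw [LieAlgebra.ad_apply, lie_smul, deg_lie_gen, smul_comm]
  simp only [Int.cast_inj] at hhom
  refine eq_top_of_deg_mem ((Submodule.smul_mem_iff I.toSubmodule hg₀).1 ?_)
  by_cases hdeg : g₀ = .deg
  · subst hdeg
    -- Trees are non-empty, so `d` is the only generator of weight `0`.
    have hfilter : {g ∈ c.support | weight g = weight .deg} = {Generator.deg} := by
      ext g
      rw [Finset.mem_filter, Finset.mem_singleton, Finsupp.mem_support_iff]
      cases g with
      | deg => simpa using hg₀
      | plus t => simp [weight, t.size_pos.ne']
      | minus t => simp [weight, t.size_pos.ne']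
    rw [hfilter, Finset.sum_singleton] at hhom
    exact hhom
  · obtain ⟨y, hy⟩ := exists_lie_gen_eq_ite hdeg
    have hmem := I.lie_mem (x := y) hhom
    have hsum : ⁅y, ∑ g ∈ c.support with weight g = weight g₀, c g • gen g⁆ =
        c g₀ • gen .deg := by
      rw [lie_sum, Finset.sum_eq_single_of_mem g₀ (by simpa using hg₀)]
      · rw [lie_smul, hy g₀ rfl, if_pos rfl]
      · intro g hg hne
        rw [lie_smul, hy g (Finset.mem_filter.1 hg).2, if_neg hne, smul_zero]
    rw [hsum] at hmem
    exact hmem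

end InsertionElimination

theorem mainTheorem2 (V : Type*) [AddCommGroup V] [Module ℂ V]
    [LieRingModule InsertionEliminationAlgebra V] [LieModule ℂ InsertionEliminationAlgebra V]
    (hV : ¬ LieModule.IsTrivial InsertionEliminationAlgebra V) :
    LieModule.IsFaithful ℂ InsertionEliminationAlgebra V := by
  rw [LieModule.isFaithful_iff_ker_eq_bot]
  by_contra hker
  have htop := InsertionElimination.eq_top_of_ne_bot hker
  refine hV ⟨fun x m => ?_⟩
  have hx : x ∈ LieModule.ker ℂ InsertionEliminationAlgebra V := htop ▸ LieSubmodule.mem_top x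
  exact (LieModule.mem_ker ℂ _ V x).1 hx m
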